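/- Let $u:\mathbb{C}^n=\mathbb{R}^{2n}\to\mathbb{R}$ be a smooth strictly convex function which solves, at every point $x\in\mathbb{C}^n$, the equation $$\ln\det\partial\bar\partial u(x)=\tfrac12\,x\cdot Du(x)-u(x),$$ where $\partial\bar\partial u=\left(\frac{\partial^2u}{\partial z^\alpha\,\partial\bar z^\beta}\right)_{1\le\alpha,\beta\le n}$ is the complex Hessian of $u$ (with $\det\partial\bar\partial u>0$, so that the logarithm is defined), $Du$ is the real gradient of $u$, and $\cdot$ is the Euclidean inner product of $\mathbb{R}^{2n}$. Assume that the eigenvalues of $\partial\bar\partial u$ are comparable, i.e. there is a constant $\Lambda\ge 1$ such that $$\mu_{\max}(x)\le\Lambda\,\mu_{\min}(x)\qquad\text{for every }x\in\mathbb{C}^n,$$ where $\mu_{\max}(x)$ and $\mu_{\min}(x)$ are the largest and the smallest eigenvalues of $\partial\bar\partial u(x)$. Then $u$ is a (real) quadratic polynomial on $\mathbb{R}^{2n}$. -/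

import Mathlib

open scoped ContDiff

noncomputable section

/-- The Wirtinger derivative `∂f/∂z^a = (∂f/∂x^a - i ∂f/∂y^a) / 2` of a complex-valued function
on `ℂⁿ`, where `z^a = x^a + i y^a`. -/
def wirtingerDz {n : ℕ} (a : Fin n) (f : EuclideanSpace ℂ (Fin n) → ℂ)
    (z : EuclideanSpace ℂ (Fin n)) : ℂ :=
  (fderiv ℝ f z (EuclideanSpace.single a 1)
    - Complex.I * fderiv ℝ f z (EuclideanSpace.single a Complex.I)) / 2

/-- The Wirtinger derivative `∂f/∂z̄^a = (∂f/∂x^a + i ∂f/∂y^a) / 2`. -/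
def wirtingerDzbar {n : ℕ} (a : Fin n) (f : EuclideanSpace ℂ (Fin n) → ℂ)
    (z : EuclideanSpace ℂ (Fin n)) : ℂ :=
  (fderiv ℝ f z (EuclideanSpace.single a 1)
    + Complex.I * fderiv ℝ f z (EuclideanSpace.single a Complex.I)) / 2

/-- The complex Hessian `∂∂̄u = (∂²u / ∂z^a ∂z̄^b)` of a real function on `ℂⁿ`.
It is a Hermitian matrix when `u` is smooth. -/
def complexHessian {n : ℕ} (u : EuclideanSpace ℂ (Fin n) → ℝ) (z : EuclideanSpace ℂ (Fin n)) :
    Matrix (Fin n) (Fin n) ℂ :=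
  Matrix.of fun a b => wirtingerDz a (wirtingerDzbar b (fun w => (u w : ℂ))) z

/-- `u` solves `ln det ∂∂̄u = (1/2) x · Du - u` on all of `ℂⁿ = ℝ²ⁿ`. The (real) determinant has to
be positive, so that its logarithm is meaningful; `x · Du(x)` is the derivative of `u` at `x` in
the direction `x`. -/
def IsKahlerRicciShrinkerPotential {n : ℕ} (u : EuclideanSpace ℂ (Fin n) → ℝ) : Prop :=
  ∀ x, 0 < (complexHessian u x).det.re ∧
    Real.log (complexHessian u x).det.re = (1 / 2) * fderiv ℝ u x x - u x

/-- The eigenvalues of `∂∂̄u` are comparable: for some constant `Λ ≥ 1`, at every point the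
largest eigenvalue is at most `Λ` times the smallest one. (The eigenvalues of a Hermitian matrix
are all real.) -/
def HasComparableEigenvalues {n : ℕ} (u : EuclideanSpace ℂ (Fin n) → ℝ) : Prop :=
  ∃ Λ : ℝ, 1 ≤ Λ ∧ ∀ x, ∀ μ ν : ℝ,
    Module.End.HasEigenvalue (Matrix.toLin' (complexHessian u x)) (μ : ℂ) →
    Module.End.HasEigenvalue (Matrix.toLin' (complexHessian u x)) (ν : ℂ) →
    μ ≤ Λ * ν

/-- `u` is a (real) quadratic polynomial on `ℂⁿ = ℝ²ⁿ`. -/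
def IsQuadraticPolynomial {n : ℕ} (u : EuclideanSpace ℂ (Fin n) → ℝ) : Prop :=
  ∃ (Q : QuadraticForm ℝ (EuclideanSpace ℂ (Fin n)))
    (l : EuclideanSpace ℂ (Fin n) →ₗ[ℝ] ℝ) (c : ℝ), ∀ x, u x = Q x + l x + c

end

/-!
Put `Φ = ½ x · Du - u`, so that the equation reads `ln det ∂∂̄u = Φ`. Differentiating the definition
of `Φ` twice gives `∂∂̄Φ = ½ ∂_x (∂∂̄u)`, where `∂_x` is the derivative in the radial direction, and
Jacobi's formula turns this into the linear elliptic equation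
`tr((∂∂̄u)⁻¹ ∂∂̄Φ) = ½ x · DΦ` without zeroth-order term
(`solvesDriftEquationAt_shrinkerPhase`). It suffices to show that `Φ` is constant: then `D³u(x)`
vanishes in the radial direction, so `D²u` is constant along rays and `u` is a quadratic form plus
a constant (`eq_quadratic_of_shrinkerPhase_const`).

Since `∏ μ_j = exp Φ` and the eigenvalues `μ_j` of `∂∂̄u` are comparable, each of them is comparable
to `exp (Φ / n)`. So the coefficients of the equation decay like `exp (-Φ / n)` where `Φ` is large,
and Osserman-type barriers `-n log (R² - |x|²)`, which blow up on the sphere of radius `R`, are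
supersolutions outside a ball independent of `R`. Letting `R → ∞` shows, with no assumption on the
growth of `Φ`, that `Φ` attains its maximum (`exists_forall_le_of_solvesDriftEquationAt`). By Hopf's
strong maximum principle (`eq_of_forall_le_of_solvesDriftEquationAt`) it is constant.

All comparison functions are radial, `ψ(|x - y|²)`, and the second derivatives are compared on real
lines, which is why the equation is used in the form of a sum over a unitary eigenframe.
-/

/-! ### Derivatives of the Legendre-type expression `½ x · Du - u` -/

/-- The expression `½ x · Du(x) - u(x)`, which equals `ln det ∂∂̄u` for a shrinker potential. -/
noncomputable def shrinkerPhase {E : Type*} [NormedAddCommGroup E] [NormedSpace ℝ E]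
    (u : E → ℝ) (x : E) : ℝ :=
  (1 / 2) * fderiv ℝ u x x - u x

section Phase

variable {E : Type*} [NormedAddCommGroup E] [NormedSpace ℝ E] {u : E → ℝ}

lemma minSmoothness_two_le_infty : minSmoothness ℝ 2 ≤ (∞ : ℕ∞ω) := by
  simpa using (by exact_mod_cast le_top : ((2 : ℕ∞) : ℕ∞ω) ≤ ∞)

lemma ContDiff.shrinkerPhase (hu : ContDiff ℝ ∞ u) : ContDiff ℝ ∞ (shrinkerPhase u) := by
  have h1 : ContDiff ℝ ∞ (fderiv ℝ u) := hu.fderiv_right (by simp)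
  exact (contDiff_const.mul (h1.clm_apply contDiff_id)).sub hu

lemma hasFDerivAt_fderiv (hu : ContDiff ℝ ∞ u) (x : E) :
    HasFDerivAt (fderiv ℝ u) (fderiv ℝ (fderiv ℝ u) x) x :=
  ((hu.fderiv_right (m := ∞) (by simp)).differentiable (by simp) x).hasFDerivAt

lemma hasFDerivAt_fderiv_fderiv (hu : ContDiff ℝ ∞ u) (x : E) :
    HasFDerivAt (fderiv ℝ (fderiv ℝ u)) (fderiv ℝ (fderiv ℝ (fderiv ℝ u)) x) x :=
  (((hu.fderiv_right (m := ∞) (by simp)).fderiv_right (m := ∞) (by simp)).differentiable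
    (by simp) x).hasFDerivAt

lemma fderiv_fderiv_symm (hu : ContDiff ℝ ∞ u) (x v w : E) :
    fderiv ℝ (fderiv ℝ u) x v w = fderiv ℝ (fderiv ℝ u) x w v :=
  (hu.contDiffAt.isSymmSndFDerivAt minSmoothness_two_le_infty).eq v w

lemma hasFDerivAt_shrinkerPhase (hu : ContDiff ℝ ∞ u) (x : E) :
    HasFDerivAt (shrinkerPhase u)
      ((1 / 2 : ℝ) • (fderiv ℝ (fderiv ℝ u) x x - fderiv ℝ u x)) x := by
  have h0 : HasFDerivAt u (fderiv ℝ u x) x := (hu.differentiable (by simp) x).hasFDerivAt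
  have h1 := (((hasFDerivAt_fderiv hu x).clm_apply (hasFDerivAt_id x)).const_mul (1 / 2 : ℝ)).sub h0
  refine h1.congr_fderiv ?_
  ext v
  have := fderiv_fderiv_symm hu x v x
  simp [this]
  ring

lemma fderiv_shrinkerPhase (hu : ContDiff ℝ ∞ u) :
    fderiv ℝ (shrinkerPhase u) =
      fun x => (1 / 2 : ℝ) • (fderiv ℝ (fderiv ℝ u) x x - fderiv ℝ u x) :=
  funext fun x => (hasFDerivAt_shrinkerPhase hu x).fderiv

/-- The second derivative of `½ x · Du - u` is half the derivative of `D²u` in the radial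
direction: this is where the exact constants of the equation matter. -/
lemma fderiv_fderiv_shrinkerPhase (hu : ContDiff ℝ ∞ u) (x : E) :
    fderiv ℝ (fderiv ℝ (shrinkerPhase u)) x =
      (1 / 2 : ℝ) • fderiv ℝ (fderiv ℝ (fderiv ℝ u)) x x := by
  rw [fderiv_shrinkerPhase hu]
  have h1 := (((hasFDerivAt_fderiv_fderiv hu x).clm_apply (hasFDerivAt_id x)).sub
    (hasFDerivAt_fderiv hu x)).const_smul (1 / 2 : ℝ)
  refine h1.fderiv.trans ?_
  ext v w
  have h1 : ContDiff ℝ ∞ (fderiv ℝ u) := hu.fderiv_right (by simp)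
  have := (h1.contDiffAt (x := x).isSymmSndFDerivAt minSmoothness_two_le_infty).eq v x
  simp [this]

/-- If `½ x · Du - u` is constant, then `D²u` is constant along rays from the origin, so that `u`
is the sum of a constant and the quadratic form `½ D²u(0)`. -/
lemma eq_quadratic_of_shrinkerPhase_const (hu : ContDiff ℝ ∞ u) {c : ℝ}
    (hc : ∀ x, shrinkerPhase u x = c) (x : E) :
    u x = (1 / 2) * fderiv ℝ (fderiv ℝ u) 0 x x - c := by
  have hconst : shrinkerPhase u = fun _ => c := funext hc
  have h1 : ∀ y, fderiv ℝ (fderiv ℝ u) y y = fderiv ℝ u y := by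
    intro y
    have h := congrFun (fderiv_shrinkerPhase hu) y
    have h0 : fderiv ℝ (shrinkerPhase u) y = 0 := by rw [hconst]; simp
    rw [h0] at h
    exact sub_eq_zero.1 ((smul_eq_zero.1 h.symm).resolve_left (by norm_num))
  have h2 : ∀ y, fderiv ℝ (fderiv ℝ (fderiv ℝ u)) y y = 0 := by
    intro y
    have h := fderiv_fderiv_shrinkerPhase hu y
    have h0 : fderiv ℝ (fderiv ℝ (shrinkerPhase u)) y = 0 := by
      rw [hconst]
      have : fderiv ℝ (fun _ : E => c) = fun _ => 0 := by ext; simp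
      rw [this]; simp
    rw [h0] at h
    exact (smul_eq_zero.1 h.symm).resolve_left (by norm_num)
  have hd : ∀ t : ℝ, HasDerivAt (fun t : ℝ => fderiv ℝ (fderiv ℝ u) (t • x) x x)
      (fderiv ℝ (fderiv ℝ (fderiv ℝ u)) (t • x) x x x) t := by
    intro t
    have hl : HasDerivAt (fun t : ℝ => t • x) x t := by
      simpa using (hasDerivAt_id t).smul_const x
    have h := ((hasFDerivAt_fderiv_fderiv hu (t • x)).clm_apply
      (hasFDerivAt_const x (t • x))).clm_apply (hasFDerivAt_const x (t • x))
    exact (h.comp_hasDerivAt (f := fun t : ℝ => t • x) t hl).congr_deriv (by simp)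
  obtain ⟨t, ht, hslope⟩ := exists_hasDerivAt_eq_slope
    (fun t : ℝ => fderiv ℝ (fderiv ℝ u) (t • x) x x) _ (zero_lt_one)
    (fun t _ => (hd t).continuousAt.continuousWithinAt) (fun t _ => hd t)
  have h3 : fderiv ℝ (fderiv ℝ (fderiv ℝ u)) (t • x) x x x = 0 := by
    have h := h2 (t • x)
    rw [map_smul] at h
    rw [(smul_eq_zero.1 h).resolve_left ht.1.ne']
    simp
  rw [h3] at hslope
  have h4 : fderiv ℝ (fderiv ℝ u) x x x = fderiv ℝ (fderiv ℝ u) 0 x x := by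
    simp at hslope
    linarith
  have h5 := hc x
  rw [shrinkerPhase, ← h1 x, h4] at h5
  linarith

end Phase

/-! ### Comparison with radial functions -/

/-- Necessary second-order condition on the line: if `f - g` has a local maximum at `0`, then
`f' = g'` and `f'' ≤ g''` there. -/
lemma IsLocalMax.second_deriv_le {f f' g g' : ℝ → ℝ} {f'' g'' : ℝ}
    (hmax : IsLocalMax (fun t => f t - g t) 0)
    (hf : ∀ᶠ t in nhds 0, HasDerivAt f (f' t) t) (hf' : HasDerivAt f' f'' 0)
    (hg : ∀ᶠ t in nhds 0, HasDerivAt g (g' t) t) (hg' : HasDerivAt g' g'' 0) :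
    f' 0 = g' 0 ∧ f'' ≤ g'' := by
  have hd : ∀ᶠ t in nhds 0, HasDerivAt (fun t => f t - g t) (f' t - g' t) t := by
    filter_upwards [hf, hg] with t h1 h2 using h1.sub h2
  have hdd : deriv (fun t => f t - g t) =ᶠ[nhds 0] fun t => f' t - g' t := by
    filter_upwards [hd] with t h using h.deriv
  have h0 : f' 0 - g' 0 = 0 := hmax.hasDerivAt_eq_zero hd.self_of_nhds
  refine ⟨sub_eq_zero.1 h0, ?_⟩
  by_contra! hlt
  have hsec : deriv (deriv fun t => f t - g t) 0 = f'' - g'' := by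
    rw [hdd.deriv_eq]; exact (hf'.sub hg').deriv
  have hmin := isLocalMin_of_deriv_deriv_pos (by rw [hsec]; linarith)
    (by rw [hd.self_of_nhds.deriv, h0]) hd.self_of_nhds.continuousAt
  -- a point that is both a local maximum and a local minimum has zero second derivative
  have hconst : (fun t => f t - g t) =ᶠ[nhds 0] fun _ => f 0 - g 0 := by
    filter_upwards [hmax, hmin] with t h1 h2 using le_antisymm h1 h2
  have : deriv (deriv fun t => f t - g t) 0 = 0 := by
    rw [hconst.deriv.deriv_eq]; simp
  rw [hsec] at this
  linarith

lemma hasDerivAt_fderiv_line {E : Type*} [NormedAddCommGroup E] [NormedSpace ℝ E] {f : E → ℝ}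
    (hf : ContDiff ℝ ∞ f) (x v : E) (t : ℝ) :
    HasDerivAt (fun t : ℝ => f (x + t • v)) (fderiv ℝ f (x + t • v) v) t ∧
    HasDerivAt (fun t : ℝ => fderiv ℝ f (x + t • v) v)
      (fderiv ℝ (fderiv ℝ f) (x + t • v) v v) t := by
  have hl : HasDerivAt (fun t : ℝ => x + t • v) v t := by
    simpa using ((hasDerivAt_id t).smul_const v).const_add x
  refine ⟨((hf.differentiable (by simp) _).hasFDerivAt).comp_hasDerivAt
    (f := fun t : ℝ => x + t • v) t hl, ?_⟩
  have h := (hasFDerivAt_fderiv hf (x + t • v)).comp_hasDerivAt (f := fun t : ℝ => x + t • v) t hl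
  simpa using h.clm_apply (hasDerivAt_const t v)

/-- First- and second-order conditions where a smooth function touches the radial function
`ψ(‖x - y‖²)` from below. -/
lemma IsLocalMax.radial_comparison {E : Type*} [NormedAddCommGroup E] [InnerProductSpace ℝ E]
    {f : E → ℝ} (hf : ContDiff ℝ ∞ f) {x y : E} {ψ ψ₁ : ℝ → ℝ} {ψ₂ : ℝ}
    (hψ : ∀ᶠ r in nhds (‖x - y‖ ^ 2), HasDerivAt ψ (ψ₁ r) r)
    (hψ₁ : HasDerivAt ψ₁ ψ₂ (‖x - y‖ ^ 2))
    (hmax : IsLocalMax (fun z => f z - ψ (‖z - y‖ ^ 2)) x) (v : E) :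
    fderiv ℝ f x v = 2 * ψ₁ (‖x - y‖ ^ 2) * inner ℝ (x - y) v ∧
    fderiv ℝ (fderiv ℝ f) x v v ≤
      4 * ψ₂ * inner ℝ (x - y) v ^ 2 + 2 * ψ₁ (‖x - y‖ ^ 2) * ‖v‖ ^ 2 := by
  set p := x - y with hp
  set q : ℝ → ℝ := fun t => ‖p‖ ^ 2 + 2 * t * inner ℝ p v + t ^ 2 * ‖v‖ ^ 2 with hq
  have hqn : ∀ t : ℝ, ‖x + t • v - y‖ ^ 2 = q t := by
    intro t
    rw [show x + t • v - y = p + t • v by rw [hp]; abel, norm_add_sq_real, inner_smul_right,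
      norm_smul, mul_pow, Real.norm_eq_abs, sq_abs]
    ring
  have hq0 : q 0 = ‖p‖ ^ 2 := by simp [hq]
  have hqd : ∀ t, HasDerivAt q (2 * inner ℝ p v + 2 * t * ‖v‖ ^ 2) t := by
    intro t
    have h1 := ((((hasDerivAt_id t).const_mul 2).mul_const (inner ℝ p v)).const_add
      (‖p‖ ^ 2)).add (((hasDerivAt_id t).pow 2).mul_const (‖v‖ ^ 2))
    refine h1.congr_deriv ?_
    simp
  have hcl : Filter.Tendsto (fun t : ℝ => x + t • v) (nhds 0) (nhds x) := by
    have : Continuous fun t : ℝ => x + t • v := by fun_prop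
    simpa using this.tendsto 0
  have hmax' : IsLocalMax (fun t : ℝ => f (x + t • v) - ψ (q t)) 0 := by
    have := hcl.eventually hmax
    simpa [IsLocalMax, IsMaxFilter, hqn, hq0] using this
  have hqt : Filter.Tendsto q (nhds 0) (nhds (‖p‖ ^ 2)) := by
    simpa [hq0] using (hqd 0).continuousAt.tendsto
  have key := hmax'.second_deriv_le
    (Filter.Eventually.of_forall fun t => (hasDerivAt_fderiv_line hf x v t).1)
    (hasDerivAt_fderiv_line hf x v 0).2
    (g' := fun t => ψ₁ (q t) * (2 * inner ℝ p v + 2 * t * ‖v‖ ^ 2))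
    (by filter_upwards [hqt.eventually hψ] with t ht using ht.comp t (hqd t))
    (((hq0 ▸ hψ₁ : HasDerivAt ψ₁ ψ₂ (q 0)).comp 0 (hqd 0)).mul
      ((((hasDerivAt_id (0 : ℝ)).const_mul 2).mul_const (‖v‖ ^ 2)).const_add (2 * inner ℝ p v)))
  simp [hq0] at key
  exact ⟨by rw [key.1]; ring, key.2.trans (le_of_eq (by ring))⟩

/-! ### Jacobi's formula and orthonormal eigenframes -/

section MatrixLemmas

open Matrix

variable {ι : Type*} [Fintype ι] [DecidableEq ι]

/-- Jacobi's formula along an entrywise differentiable curve of invertible matrices. -/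
lemma hasDerivAt_det_curve {A : ℝ → Matrix ι ι ℂ} {K : Matrix ι ι ℂ} {t₀ : ℝ}
    (hA : ∀ a b, HasDerivAt (fun t => A t a b) (K a b) t₀) (hdet : IsUnit (A t₀).det) :
    HasDerivAt (fun t => (A t).det) ((A t₀).det * ((A t₀)⁻¹ * K).trace) t₀ := by
  set F : (ι → ι → ℂ) → ℂ := fun B => ∑ σ : Equiv.Perm ι, Equiv.Perm.sign σ • ∏ i, B (σ i) i
    with hF
  have hFd : Differentiable ℝ F := by
    rw [hF]; fun_prop
  have hFdet : ∀ B : Matrix ι ι ℂ, F B = B.det := fun B => (Matrix.det_apply B).symm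
  -- the directional derivative of the determinant is computed along a line
  have hline : HasDerivAt (fun t : ℝ => F (A t₀ + t • K))
      ((A t₀).det * ((A t₀)⁻¹ * K).trace) 0 := by
    set P := (det (1 + (Polynomial.X : Polynomial ℂ) •
      ((A t₀)⁻¹ * K).map Polynomial.C)).divX.divX with hP
    have hexp : ∀ t : ℝ, F (A t₀ + t • K) = (A t₀).det *
        (1 + ((A t₀)⁻¹ * K).trace * (t : ℂ) + P.eval (t : ℂ) * (t : ℂ) ^ 2) := by
      intro t
      have h1 : A t₀ + t • K = A t₀ * (1 + (t : ℂ) • ((A t₀)⁻¹ * K)) := by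
        rw [mul_add, mul_one, mul_smul_comm, Matrix.mul_nonsing_inv_cancel_left _ _ hdet]
        rfl
      change F ((A t₀ + t • K : Matrix ι ι ℂ)) = _
      rw [h1, hFdet, det_mul, det_one_add_smul]
    have hd : HasDerivAt (fun z : ℂ => (A t₀).det *
        (1 + ((A t₀)⁻¹ * K).trace * z + P.eval z * z ^ 2))
        ((A t₀).det * ((A t₀)⁻¹ * K).trace) ((0 : ℝ) : ℂ) := by
      have h1 := ((((hasDerivAt_id (((0 : ℝ) : ℂ))).const_mul ((A t₀)⁻¹ * K).trace).const_add 1).add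
        ((P.hasDerivAt (((0 : ℝ) : ℂ))).mul ((hasDerivAt_id (((0 : ℝ) : ℂ))).pow 2))).const_mul
        (A t₀).det
      exact h1.congr_deriv (by simp)
    have h2 := hd.comp_ofReal
    simpa only [hexp] using h2
  set A₀ : ι → ι → ℂ := fun a b => A t₀ a b with hA₀
  set K₀ : ι → ι → ℂ := fun a b => K a b with hK₀
  have h1 : fderiv ℝ F A₀ K₀ = (A t₀).det * ((A t₀)⁻¹ * K).trace := by
    have hl : HasDerivAt (fun t : ℝ => A₀ + t • K₀) K₀ 0 := by
      simpa using ((hasDerivAt_id (0 : ℝ)).smul_const K₀).const_add A₀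
    have hFl : HasFDerivAt F (fderiv ℝ F A₀) (A₀ + (0 : ℝ) • K₀) := by
      have h0 : A₀ + (0 : ℝ) • K₀ = A₀ := by simp
      rw [h0]; exact (hFd A₀).hasFDerivAt
    exact (hFl.comp_hasDerivAt (f := fun t : ℝ => A₀ + t • K₀) 0 hl).unique hline
  have hcurve : HasDerivAt (fun t => (fun a b => A t a b : ι → ι → ℂ)) K₀ t₀ := by
    rw [hasDerivAt_pi]; intro a; rw [hasDerivAt_pi]; intro b
    exact hA a b
  have h3 := ((hFd A₀).hasFDerivAt).comp_hasDerivAt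
    (f := fun t => (fun a b => A t a b : ι → ι → ℂ)) t₀ hcurve
  rw [h1] at h3
  exact h3.congr_of_eventuallyEq (Filter.Eventually.of_forall fun t => (hFdet (A t)).symm)

/-- The trace of `H⁻¹ K` in an orthonormal eigenbasis of `H`. -/
lemma Matrix.IsHermitian.trace_inv_mul {H : Matrix ι ι ℂ} (hH : H.IsHermitian)
    (hpos : ∀ j, 0 < hH.eigenvalues j) (K : Matrix ι ι ℂ) :
    (H⁻¹ * K).trace = ∑ j, ((hH.eigenvalues j)⁻¹ : ℝ) *
      (star ⇑(hH.eigenvectorBasis j) ⬝ᵥ K *ᵥ ⇑(hH.eigenvectorBasis j)) := by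
  have hdet : IsUnit H.det := by
    rw [hH.det_eq_prod_eigenvalues, isUnit_iff_ne_zero, Finset.prod_ne_zero_iff]
    intro j _
    exact RCLike.ofReal_ne_zero.2 (hpos j).ne'
  have hinv : ∀ j, H⁻¹ *ᵥ ⇑(hH.eigenvectorBasis j) =
      ((hH.eigenvalues j)⁻¹ : ℝ) • ⇑(hH.eigenvectorBasis j) := by
    intro j
    have h1 := congrArg (fun v => (hH.eigenvalues j)⁻¹ • (H⁻¹ *ᵥ v)) (hH.mulVec_eigenvectorBasis j)
    simp only [mulVec_mulVec, Matrix.nonsing_inv_mul _ hdet, one_mulVec, mulVec_smul] at h1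
    rw [smul_smul, inv_mul_cancel₀ (hpos j).ne', one_smul] at h1
    exact h1.symm
  rw [Matrix.trace_mul_comm]
  have htr : (K * H⁻¹).trace = LinearMap.trace ℂ (EuclideanSpace ℂ ι)
      (toEuclideanLin (K * H⁻¹)) := by
    rw [LinearMap.trace_eq_matrix_trace ℂ (EuclideanSpace.basisFun ι ℂ).toBasis,
      Matrix.toEuclideanLin_eq_toLin_orthonormal, LinearMap.toMatrix_toLin]
  rw [htr, LinearMap.trace_eq_sum_inner _ hH.eigenvectorBasis]
  refine Finset.sum_congr rfl fun j _ => ?_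
  rw [EuclideanSpace.inner_eq_star_dotProduct, Matrix.toLpLin_apply, ← mulVec_mulVec, hinv,
    mulVec_smul, dotProduct_comm]
  simp

end MatrixLemmas

/-! ### The complex Hessian as a Hermitian form -/

section Levi

open Matrix

variable {n : ℕ}

/-- The Levi form of a real bilinear form on `ℂⁿ`, as a matrix. For the second derivative of a
function it is the transpose of the complex Hessian, so that
`ξ* L ξ = ¼ (B(ξ, ξ) + B(iξ, iξ))`. -/
noncomputable def leviMatrix
    (B : EuclideanSpace ℂ (Fin n) →L[ℝ] EuclideanSpace ℂ (Fin n) →L[ℝ] ℝ) :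
    Matrix (Fin n) (Fin n) ℂ :=
  Matrix.of fun a b =>
    (((B (EuclideanSpace.single b 1) (EuclideanSpace.single a 1)
      + B (EuclideanSpace.single b Complex.I) (EuclideanSpace.single a Complex.I) : ℝ) : ℂ)
    + Complex.I * ((B (EuclideanSpace.single b 1) (EuclideanSpace.single a Complex.I)
      - B (EuclideanSpace.single b Complex.I) (EuclideanSpace.single a 1) : ℝ) : ℂ)) / 4

lemma complexHessian_eq_transpose_leviMatrix {u : EuclideanSpace ℂ (Fin n) → ℝ}
    (hu : ContDiff ℝ ∞ u) (x : EuclideanSpace ℂ (Fin n)) :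
    complexHessian u x = (leviMatrix (fderiv ℝ (fderiv ℝ u) x))ᵀ := by
  have h1 : ∀ w, fderiv ℝ (fun w => (u w : ℂ)) w = Complex.ofRealCLM ∘L fderiv ℝ u w := fun w =>
    (Complex.ofRealCLM.hasFDerivAt.comp w (hu.differentiable (by simp) w).hasFDerivAt).fderiv
  have h2 : ∀ v, HasFDerivAt (fun w => (fderiv ℝ u w v : ℂ))
      (Complex.ofRealCLM ∘L (fderiv ℝ (fderiv ℝ u) x).flip v) x := by
    intro v
    have h3 := (hasFDerivAt_fderiv hu x).clm_apply (hasFDerivAt_const v x)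
    refine (Complex.ofRealCLM.hasFDerivAt.comp x h3).congr_fderiv ?_
    ext w; simp
  ext a b
  have h4 := ((h2 (EuclideanSpace.single b 1)).add
    ((h2 (EuclideanSpace.single b Complex.I)).const_mul Complex.I)).mul_const (2⁻¹ : ℂ)
  have h5 : wirtingerDzbar b (fun w => (u w : ℂ)) = fun w =>
      ((fderiv ℝ u w (EuclideanSpace.single b 1) : ℂ) +
        Complex.I * (fderiv ℝ u w (EuclideanSpace.single b Complex.I) : ℂ)) * 2⁻¹ := by
    ext w
    simp [wirtingerDzbar, h1, div_eq_mul_inv]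
  have h6 := h4.fderiv
  simp only [Pi.add_apply] at h6
  simp only [complexHessian, Matrix.of_apply, wirtingerDz, h5, h6, Matrix.transpose_apply,
    leviMatrix]
  simp
  ring_nf
  simp
  ring

lemma leviMatrix_isHermitian
    {B : EuclideanSpace ℂ (Fin n) →L[ℝ] EuclideanSpace ℂ (Fin n) →L[ℝ] ℝ}
    (hB : ∀ v w, B v w = B w v) : (leviMatrix B).IsHermitian := by
  ext a b
  simp only [leviMatrix, Matrix.conjTranspose_apply, Matrix.of_apply]
  rw [hB (EuclideanSpace.single a 1) (EuclideanSpace.single b 1),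
    hB (EuclideanSpace.single a Complex.I) (EuclideanSpace.single b Complex.I),
    hB (EuclideanSpace.single a 1) (EuclideanSpace.single b Complex.I),
    hB (EuclideanSpace.single a Complex.I) (EuclideanSpace.single b 1)]
  simp
  ring

lemma eq_sum_re_im (ξ : EuclideanSpace ℂ (Fin n)) :
    ξ = ∑ a, ((ξ a).re • EuclideanSpace.single a (1 : ℂ)
      + (ξ a).im • EuclideanSpace.single a Complex.I) := by
  ext b
  simp [Finset.sum_add_distrib, Pi.single_apply, Complex.re_add_im]

lemma re_star_dotProduct_leviMatrix
    (B : EuclideanSpace ℂ (Fin n) →L[ℝ] EuclideanSpace ℂ (Fin n) →L[ℝ] ℝ)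
    (ξ : EuclideanSpace ℂ (Fin n)) :
    (star ⇑ξ ⬝ᵥ leviMatrix B *ᵥ ⇑ξ).re =
      (B ξ ξ + B (Complex.I • ξ) (Complex.I • ξ)) / 4 := by
  have h1 := eq_sum_re_im ξ
  have h2 : Complex.I • ξ = ∑ a, ((-(ξ a).im) • EuclideanSpace.single a (1 : ℂ)
      + (ξ a).re • EuclideanSpace.single a Complex.I) := by
    conv_lhs => rw [eq_sum_re_im (Complex.I • ξ)]
    simp
  have h3 : B ξ ξ = B (∑ a, ((ξ a).re • EuclideanSpace.single a (1 : ℂ)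
      + (ξ a).im • EuclideanSpace.single a Complex.I)) (∑ a, ((ξ a).re •
      EuclideanSpace.single a (1 : ℂ) + (ξ a).im • EuclideanSpace.single a Complex.I)) := by
    rw [← h1]
  rw [h3, h2]
  simp only [map_sum, map_add, map_smul, _root_.sum_apply, _root_.add_apply,
    _root_.smul_apply, dotProduct, mulVec,
    Complex.re_sum, Finset.mul_sum, Finset.smul_sum]
  rw [← Finset.sum_add_distrib, Finset.sum_div]
  refine Finset.sum_congr rfl fun a _ => ?_
  simp only [← Finset.sum_add_distrib]
  rw [Finset.sum_div]
  refine Finset.sum_congr rfl fun b _ => ?_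
  simp [leviMatrix]
  ring

end Levi

/-! ### The elliptic equation for the phase -/

section Frame

open Matrix

variable {n : ℕ}

/-- At `x` the function `Φ` satisfies `tr(H⁻¹ ∂∂̄Φ) = ½ x · DΦ` for some Hermitian form `H` that is
diagonal in a unitary frame `b`, with positive entries `l j` whose product is `exp Φ(x)` and whose
ratios are at most `Λ`. The complex Hessian of `Φ` in the direction `b j` is written as
`¼ (D²Φ(b j, b j) + D²Φ(i b j, i b j))`, so that only real derivatives occur. -/
def SolvesDriftEquationAt (Φ : EuclideanSpace ℂ (Fin n) → ℝ) (Λ : ℝ)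
    (x : EuclideanSpace ℂ (Fin n)) : Prop :=
  ∃ (b : OrthonormalBasis (Fin n) ℂ (EuclideanSpace ℂ (Fin n))) (l : Fin n → ℝ),
    (∀ j, 0 < l j) ∧ (∀ i j, l i ≤ Λ * l j) ∧ ∏ j, l j = Real.exp (Φ x) ∧
    (1 / 2) * fderiv ℝ Φ x x = ∑ j, (l j)⁻¹ *
      ((fderiv ℝ (fderiv ℝ Φ) x (b j) (b j)
        + fderiv ℝ (fderiv ℝ Φ) x (Complex.I • b j) (Complex.I • b j)) / 4)

lemma ConvexOn.fderiv_fderiv_nonneg {E : Type*} [NormedAddCommGroup E] [NormedSpace ℝ E]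
    {u : E → ℝ} (hu : ContDiff ℝ ∞ u) (hc : ConvexOn ℝ Set.univ u) (x v : E) :
    0 ≤ fderiv ℝ (fderiv ℝ u) x v v := by
  have h1 : ConvexOn ℝ Set.univ (fun t : ℝ => u (x + t • v)) := by
    refine ⟨convex_univ, fun s _ t _ a b ha hb hab => ?_⟩
    have h := hc.2 (Set.mem_univ (x + s • v)) (Set.mem_univ (x + t • v)) ha hb hab
    refine le_trans (le_of_eq (congrArg u ?_)) h
    rw [smul_add, smul_add, add_add_add_comm, ← add_smul, hab, one_smul, smul_smul, smul_smul,
      ← add_smul]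
    simp
  have h2 := h1.monotoneOn_deriv
    (fun t _ => (hasDerivAt_fderiv_line hu x v t).1.differentiableAt)
  rw [monotoneOn_univ] at h2
  have h3 : deriv (fun t : ℝ => u (x + t • v)) = fun t => fderiv ℝ u (x + t • v) v :=
    funext fun t => (hasDerivAt_fderiv_line hu x v t).1.deriv
  have h4 := h2.deriv_nonneg (x := 0)
  rw [h3, (hasDerivAt_fderiv_line hu x v 0).2.deriv] at h4
  simpa using h4

/-- Differentiating `ln det ∂∂̄u = Φ` in the radial direction gives the drift equation for
`Φ = ½ x · Du - u`, because `∂∂̄Φ` is half the radial derivative of `∂∂̄u`. Convexity makes the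
complex Hessian, whose determinant is positive, positive definite. -/
lemma solvesDriftEquationAt_shrinkerPhase {u : EuclideanSpace ℂ (Fin n) → ℝ}
    (hu : ContDiff ℝ ∞ u) (hconv : ConvexOn ℝ Set.univ u)
    (hsol : IsKahlerRicciShrinkerPotential u) {Λ : ℝ}
    (hcomp : ∀ x, ∀ μ ν : ℝ,
      Module.End.HasEigenvalue (Matrix.toLin' (complexHessian u x)) (μ : ℂ) →
      Module.End.HasEigenvalue (Matrix.toLin' (complexHessian u x)) (ν : ℂ) → μ ≤ Λ * ν)
    (x : EuclideanSpace ℂ (Fin n)) : SolvesDriftEquationAt (shrinkerPhase u) Λ x := by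
  set L : EuclideanSpace ℂ (Fin n) → Matrix (Fin n) (Fin n) ℂ :=
    fun y => leviMatrix (fderiv ℝ (fderiv ℝ u) y) with hL
  have hdet : ∀ y, (complexHessian u y).det = (L y).det := fun y => by
    rw [complexHessian_eq_transpose_leviMatrix hu, det_transpose]
  have hherm : ∀ y, (L y).IsHermitian := fun y =>
    leviMatrix_isHermitian (fderiv_fderiv_symm hu y)
  have hH := hherm x
  have hprod : (L x).det = ((∏ j, hH.eigenvalues j : ℝ) : ℂ) := by
    rw [hH.det_eq_prod_eigenvalues]; push_cast; rfl
  obtain ⟨hdpos, hlog⟩ := hsol x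
  rw [hdet, hprod, Complex.ofReal_re] at hdpos
  have hform : ∀ (K : EuclideanSpace ℂ (Fin n) →L[ℝ] EuclideanSpace ℂ (Fin n) →L[ℝ] ℝ) (j),
      (star ⇑(hH.eigenvectorBasis j) ⬝ᵥ leviMatrix K *ᵥ ⇑(hH.eigenvectorBasis j)).re =
      (K (hH.eigenvectorBasis j) (hH.eigenvectorBasis j) +
        K (Complex.I • hH.eigenvectorBasis j) (Complex.I • hH.eigenvectorBasis j)) / 4 :=
    fun K j => re_star_dotProduct_leviMatrix K _
  have hpos : ∀ j, 0 < hH.eigenvalues j := by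
    intro j
    have h1 : 0 ≤ hH.eigenvalues j := by
      rw [hH.eigenvalues_eq j]
      refine le_of_le_of_eq ?_ (hform (fderiv ℝ (fderiv ℝ u) x) j).symm
      have h2 := ConvexOn.fderiv_fderiv_nonneg hu hconv x (hH.eigenvectorBasis j)
      have h3 := ConvexOn.fderiv_fderiv_nonneg hu hconv x (Complex.I • hH.eigenvectorBasis j)
      positivity
    exact h1.lt_of_ne' fun h0 => hdpos.ne' (Finset.prod_eq_zero (Finset.mem_univ j) h0)
  have heig : ∀ j, Module.End.HasEigenvalue (Matrix.toLin' (complexHessian u x))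
      (hH.eigenvalues j : ℂ) := by
    intro j
    rw [Module.End.hasEigenvalue_iff_isRoot_charpoly, Matrix.charpoly_toLin',
      complexHessian_eq_transpose_leviMatrix hu, Matrix.charpoly_transpose]
    have h1 : (L x).charpoly.IsRoot (hH.eigenvalues j : ℂ) := by
      rw [hH.charpoly_eq, Polynomial.IsRoot, Polynomial.eval_prod]
      exact Finset.prod_eq_zero (Finset.mem_univ j) (by simp)
    exact h1
  refine ⟨hH.eigenvectorBasis, hH.eigenvalues, hpos, fun i j => hcomp x _ _ (heig i) (heig j),
    ?_, ?_⟩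
  · rw [shrinkerPhase, ← hlog, hdet, hprod, Complex.ofReal_re, Real.exp_log hdpos]
  -- both sides are the derivative of `Φ = ln det` along the curve `x + t x`
  set K := fderiv ℝ (fderiv ℝ (fderiv ℝ u)) x x with hK
  have hcurve : ∀ a b, HasDerivAt (fun t : ℝ => L (x + t • x) a b) (leviMatrix K a b) 0 := by
    intro a b
    have hx : x + (0 : ℝ) • x = x := by simp
    have hl : HasDerivAt (fun t : ℝ => x + t • x) x 0 := by
      simpa using ((hasDerivAt_id (0 : ℝ)).smul_const x).const_add x
    have hB : ∀ v w, HasDerivAt (fun t : ℝ => ((fderiv ℝ (fderiv ℝ u) (x + t • x) v w : ℝ) : ℂ))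
        ((K v w : ℝ) : ℂ) 0 := by
      intro v w
      have h := ((hasFDerivAt_fderiv_fderiv hu (x + (0 : ℝ) • x)).clm_apply
        (hasFDerivAt_const v (x + (0 : ℝ) • x))).clm_apply (hasFDerivAt_const w (x + (0 : ℝ) • x))
      refine HasDerivAt.ofReal_comp ?_
      exact (h.comp_hasDerivAt (f := fun t : ℝ => x + t • x) 0 hl).congr_deriv (by simp [hK])
    have h := (((hB (EuclideanSpace.single b 1) (EuclideanSpace.single a 1)).add
      (hB (EuclideanSpace.single b Complex.I) (EuclideanSpace.single a Complex.I))).add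
      (((hB (EuclideanSpace.single b 1) (EuclideanSpace.single a Complex.I)).sub
      (hB (EuclideanSpace.single b Complex.I) (EuclideanSpace.single a 1))).const_mul
        Complex.I)).div_const 4
    refine (h.congr_deriv ?_).congr_of_eventuallyEq (Filter.Eventually.of_forall fun t => ?_)
    · simp [leviMatrix]
    · simp [hL, leviMatrix]
  have hunit : IsUnit (L (x + (0 : ℝ) • x)).det := by
    rw [zero_smul, add_zero, hprod, isUnit_iff_ne_zero]
    exact_mod_cast hdpos.ne'
  have hD := hasDerivAt_det_curve hcurve hunit
  rw [zero_smul, add_zero, hH.trace_inv_mul hpos, hprod] at hD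
  have hDre := (Complex.reCLM.hasFDerivAt.comp_hasDerivAt (0 : ℝ) hD)
  have hne : (Complex.reCLM ∘ fun t : ℝ => (L (x + t • x)).det) 0 ≠ 0 := by
    simp only [Function.comp, zero_smul, add_zero, hprod, Complex.reCLM_apply, Complex.ofReal_re]
    exact hdpos.ne'
  have hlogD := hDre.log hne
  have hphase : HasDerivAt (fun t : ℝ => shrinkerPhase u (x + t • x))
      (fderiv ℝ (shrinkerPhase u) x x) 0 := by
    simpa using (hasDerivAt_fderiv_line hu.shrinkerPhase x x 0).1
  have heq : (fun t : ℝ => shrinkerPhase u (x + t • x)) =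
      fun t => Real.log ((Complex.reCLM ∘ fun t : ℝ => (L (x + t • x)).det) t) := by
    funext t
    rw [shrinkerPhase, ← (hsol (x + t • x)).2, hdet]
    rfl
  rw [heq] at hphase
  rw [hphase.unique hlogD, fderiv_fderiv_shrinkerPhase hu]
  simp only [Function.comp, zero_smul, add_zero, hprod, Complex.reCLM_apply, Complex.ofReal_re,
    Complex.re_ofReal_mul, Complex.re_sum, hform]
  rw [mul_div_cancel_left₀ _ hdpos.ne', Finset.mul_sum]
  refine Finset.sum_congr rfl fun j _ => ?_
  simp [hK]
  ring

end Frame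

section Frame

variable {n : ℕ}

/-! ### Touching by radial functions -/

/-- If the product of `n` positive numbers with ratios at most `Λ` is `exp t`, each of them is
comparable to `exp (t / n)`. -/
lemma comparable_of_prod_eq_exp (hn : 0 < n) {Λ t : ℝ} {l : Fin n → ℝ}
    (hpos : ∀ j, 0 < l j) (hcomp : ∀ i j, l i ≤ Λ * l j) (hprod : ∏ j, l j = Real.exp t)
    (j : Fin n) : Real.exp (t / n) ≤ Λ * l j ∧ l j ≤ Λ * Real.exp (t / n) := by
  have hΛ : 0 < Λ := pos_of_mul_pos_left ((hpos j).trans_le (hcomp j j)) (hpos j).le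
  have hexp : Real.exp (t / n) ^ n = Real.exp t := by
    rw [← Real.exp_nat_mul, mul_div_cancel₀]
    exact_mod_cast hn.ne'
  constructor
  · refine le_of_pow_le_pow_left₀ hn.ne' (mul_pos hΛ (hpos j)).le ?_
    rw [hexp, ← hprod]
    calc ∏ i, l i ≤ ∏ _i : Fin n, Λ * l j :=
          Finset.prod_le_prod (fun i _ => (hpos i).le) fun i _ => hcomp i j
      _ = (Λ * l j) ^ n := by simp
  · refine le_of_pow_le_pow_left₀ hn.ne' (mul_pos hΛ (Real.exp_pos _)).le ?_
    rw [mul_pow, hexp, ← hprod]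
    calc l j ^ n = ∏ _i : Fin n, l j := by simp
      _ ≤ ∏ i, Λ * l i := Finset.prod_le_prod (fun i _ => (hpos j).le) fun i _ => hcomp j i
      _ = Λ ^ n * ∏ i, l i := by simp [Finset.prod_mul_distrib]

lemma real_inner_sq_add (p b : EuclideanSpace ℂ (Fin n)) :
    inner ℝ p b ^ 2 + inner ℝ p (Complex.I • b) ^ 2 = ‖inner ℂ p b‖ ^ 2 := by
  have h : ∀ c : EuclideanSpace ℂ (Fin n), inner ℝ p c = (inner ℂ p c).re := fun c => by
    simp [PiLp.inner_apply]
  rw [h, h, inner_smul_right, Complex.sq_norm, Complex.normSq_apply]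
  simp
  ring

/-- The drift equation at a point where a radial function `ψ(‖· - y‖²)` touches `Φ` from above. -/
lemma SolvesDriftEquationAt.radial_comparison {Φ : EuclideanSpace ℂ (Fin n) → ℝ} {Λ : ℝ}
    {x y : EuclideanSpace ℂ (Fin n)} (h : SolvesDriftEquationAt Φ Λ x) (hΦ : ContDiff ℝ ∞ Φ)
    {ψ ψ₁ : ℝ → ℝ} {ψ₂ : ℝ} (hψ : ∀ᶠ r in nhds (‖x - y‖ ^ 2), HasDerivAt ψ (ψ₁ r) r)
    (hψ₁ : HasDerivAt ψ₁ ψ₂ (‖x - y‖ ^ 2))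
    (hmax : IsLocalMax (fun z => Φ z - ψ (‖z - y‖ ^ 2)) x) (hn : 0 < n) :
    ∃ (b : OrthonormalBasis (Fin n) ℂ (EuclideanSpace ℂ (Fin n))) (l : Fin n → ℝ),
      (∀ j, 0 < l j) ∧
      (∀ j, Real.exp (Φ x / n) ≤ Λ * l j ∧ l j ≤ Λ * Real.exp (Φ x / n)) ∧
      ψ₁ (‖x - y‖ ^ 2) * inner ℝ (x - y) x ≤
        ∑ j, (l j)⁻¹ * (ψ₂ * ‖inner ℂ (x - y) (b j)‖ ^ 2 + ψ₁ (‖x - y‖ ^ 2)) := by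
  obtain ⟨b, l, hpos, hcomp, hprod, heq⟩ := h
  refine ⟨b, l, hpos, comparable_of_prod_eq_exp hn hpos hcomp hprod, ?_⟩
  have hr := hmax.radial_comparison hΦ hψ hψ₁
  have h1 : ψ₁ (‖x - y‖ ^ 2) * inner ℝ (x - y) x = (1 / 2) * fderiv ℝ Φ x x := by
    rw [(hr x).1]; ring
  rw [h1, heq]
  refine Finset.sum_le_sum fun j _ => mul_le_mul_of_nonneg_left ?_ (inv_pos.2 (hpos j)).le
  have h2 := (hr (b j)).2
  have h3 := (hr (Complex.I • b j)).2
  have hb : ‖b j‖ = 1 := b.orthonormal.1 j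
  have hIb : ‖Complex.I • b j‖ = 1 := by rw [norm_smul, hb]; simp
  rw [hb] at h2
  rw [hIb] at h3
  rw [← real_inner_sq_add]
  linarith

/-! ### The phase attains its maximum -/

/-- Comparison with `-n log (R² - |x|²)`: the point where `(R² - |x|²) exp (Φ/n)` is maximal stays
in a ball that does not depend on `R`. The barrier blows up on the sphere of radius `R`, and its
growth is matched by the decay of the coefficients `1 / l j ≤ Λ exp (-Φ/n)`, which is why no growth
assumption on `Φ` is needed. -/
lemma norm_sq_le_of_isMaxOn {Φ : EuclideanSpace ℂ (Fin n) → ℝ} {Λ : ℝ} (hn : 0 < n)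
    (hΦ : ContDiff ℝ ∞ Φ) (h : ∀ x, SolvesDriftEquationAt Φ Λ x) (hΛ : 0 < Λ) {R : ℝ} (hR : 0 < R)
    {x : EuclideanSpace ℂ (Fin n)}
    (hmax : ∀ z, (R ^ 2 - ‖z‖ ^ 2) * Real.exp (Φ z / n) ≤ (R ^ 2 - ‖x‖ ^ 2) * Real.exp (Φ x / n)) :
    ‖x‖ ^ 2 ≤ (n + 1) * Λ * Real.exp (-(Φ 0 / n)) := by
  have hn' : (0 : ℝ) < n := by exact_mod_cast hn
  have h0 : R ^ 2 * Real.exp (Φ 0 / n) ≤ (R ^ 2 - ‖x‖ ^ 2) * Real.exp (Φ x / n) := by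
    simpa using hmax 0
  set s := R ^ 2 - ‖x‖ ^ 2 with hs
  have hspos : 0 < s := by
    have : 0 < s * Real.exp (Φ x / n) := lt_of_lt_of_le (by positivity) h0
    exact pos_of_mul_pos_left this (Real.exp_pos _).le
  have hloc : IsLocalMax
      (fun z => Φ z - (fun r => -(n * Real.log (R ^ 2 - r))) (‖z - 0‖ ^ 2)) x := by
    have hev : ∀ᶠ z in nhds x, 0 < R ^ 2 - ‖z‖ ^ 2 :=
      (by fun_prop : Continuous fun z : EuclideanSpace ℂ (Fin n) => R ^ 2 - ‖z‖ ^ 2).continuousAt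
        |>.eventually (lt_mem_nhds hspos)
    filter_upwards [hev] with z hz
    have h1 := Real.log_le_log (mul_pos hz (Real.exp_pos _)) (hmax z)
    rw [Real.log_mul hz.ne' (Real.exp_pos _).ne', Real.log_mul hspos.ne' (Real.exp_pos _).ne',
      Real.log_exp, Real.log_exp] at h1
    have h2 := mul_le_mul_of_nonneg_left h1 hn'.le
    rw [mul_add, mul_add, mul_div_cancel₀ _ hn'.ne', mul_div_cancel₀ _ hn'.ne'] at h2
    simp only [sub_zero]
    linarith
  have hψ : ∀ r : ℝ, 0 < R ^ 2 - r →
      HasDerivAt (fun r => -(n * Real.log (R ^ 2 - r))) (n / (R ^ 2 - r)) r := by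
    intro r hr
    have h1 := ((((hasDerivAt_id r).const_sub (R ^ 2)).log hr.ne').const_mul (n : ℝ)).neg
    refine h1.congr_deriv ?_
    simp
    ring
  have hψ₁ : HasDerivAt (fun r => n / (R ^ 2 - r)) (n / s ^ 2) (‖x - 0‖ ^ 2) := by
    rw [sub_zero]
    have h1 := (hasDerivAt_const (‖x‖ ^ 2) (n : ℝ)).div
      ((hasDerivAt_id (‖x‖ ^ 2)).const_sub (R ^ 2)) hspos.ne'
    refine h1.congr_deriv ?_
    simp [hs]
  obtain ⟨b, l, hpos, hexp, hineq⟩ := (h x).radial_comparison hΦ (y := 0)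
    (by
      rw [sub_zero]
      have hev : ∀ᶠ r in nhds (‖x‖ ^ 2), 0 < R ^ 2 - r :=
        (by fun_prop : Continuous fun r : ℝ => R ^ 2 - r).continuousAt
          |>.eventually (lt_mem_nhds hspos)
      filter_upwards [hev] with r hr using hψ r hr) hψ₁ hloc hn
  rw [sub_zero, real_inner_self_eq_norm_sq, ← hs] at hineq
  set e := Real.exp (Φ x / n) with he
  have hepos : 0 < e := Real.exp_pos _
  have hinv : ∀ j, (l j)⁻¹ ≤ Λ / e := fun j => by
    rw [inv_le_comm₀ (hpos j) (by positivity), inv_div, div_le_iff₀ hΛ, mul_comm]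
    exact (hexp j).1
  have hsum : n / s * ‖x‖ ^ 2 ≤ Λ / e * (n / s ^ 2 * ‖x‖ ^ 2 + n * (n / s)) := by
    refine hineq.trans ?_
    calc _ ≤ ∑ j, Λ / e * (n / s ^ 2 * ‖inner ℂ x (b j)‖ ^ 2 + n / s) :=
          Finset.sum_le_sum fun j _ => mul_le_mul_of_nonneg_right (hinv j) (by positivity)
      _ = _ := by
          rw [← Finset.mul_sum, Finset.sum_add_distrib, ← Finset.mul_sum,
            b.sum_sq_norm_inner_left]
          simp
  have h1 : ‖x‖ ^ 2 * (s * e) ≤ Λ * (‖x‖ ^ 2 + n * s) := by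
    have h2 := mul_le_mul_of_nonneg_left hsum (by positivity : 0 ≤ s ^ 2 * e / n)
    have h3 : s ^ 2 * e / n * (n / s * ‖x‖ ^ 2) = ‖x‖ ^ 2 * (s * e) := by field_simp
    have h4 : s ^ 2 * e / n * (Λ / e * (n / s ^ 2 * ‖x‖ ^ 2 + n * (n / s))) =
        Λ * (‖x‖ ^ 2 + n * s) := by field_simp
    rwa [h3, h4] at h2
  have h2 : ‖x‖ ^ 2 + n * s ≤ (n + 1) * R ^ 2 := by
    have : ‖x‖ ^ 2 ≤ R ^ 2 := by linarith
    have : n * s ≤ n * R ^ 2 :=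
      mul_le_mul_of_nonneg_left (by rw [hs]; linarith [sq_nonneg ‖x‖]) hn'.le
    linarith
  have h3 : ‖x‖ ^ 2 * (R ^ 2 * Real.exp (Φ 0 / n)) ≤ Λ * ((n + 1) * R ^ 2) :=
    (mul_le_mul_of_nonneg_left h0 (sq_nonneg _)).trans
      (h1.trans (mul_le_mul_of_nonneg_left h2 hΛ.le))
  rw [Real.exp_neg, ← div_eq_mul_inv, le_div_iff₀ (Real.exp_pos _)]
  refine le_of_mul_le_mul_left ?_ (by positivity : 0 < R ^ 2)
  linarith

/-- Letting `R → ∞` in the comparison with `-n log (R² - |x|²)`. -/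
lemma exists_forall_le_of_solvesDriftEquationAt {Φ : EuclideanSpace ℂ (Fin n) → ℝ} {Λ : ℝ}
    (hn : 0 < n) (hΦ : ContDiff ℝ ∞ Φ) (h : ∀ x, SolvesDriftEquationAt Φ Λ x) (hΛ : 0 < Λ) :
    ∃ x₀, ∀ x, Φ x ≤ Φ x₀ := by
  have hn' : (0 : ℝ) < n := by exact_mod_cast hn
  have hcont : Continuous Φ := hΦ.continuous
  set ρ := √((n + 1) * Λ * Real.exp (-(Φ 0 / n))) with hρ
  obtain ⟨x₀, -, hx₀⟩ := (isCompact_closedBall (0 : EuclideanSpace ℂ (Fin n)) ρ).exists_isMaxOn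
    ⟨0, by simp [hρ]⟩ hcont.continuousOn
  refine ⟨x₀, fun x => ?_⟩
  have key : ∀ R : ℝ, 0 < R →
      (R ^ 2 - ‖x‖ ^ 2) * Real.exp (Φ x / n) ≤ R ^ 2 * Real.exp (Φ x₀ / n) := by
    intro R hR
    obtain ⟨z, hz, hzmax⟩ := (isCompact_closedBall (0 : EuclideanSpace ℂ (Fin n)) R).exists_isMaxOn
      ⟨0, by simpa using hR.le⟩
      (by fun_prop : Continuous fun z => (R ^ 2 - ‖z‖ ^ 2) * Real.exp (Φ z / n)).continuousOn
    rw [mem_closedBall_zero_iff] at hz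
    have hz2 : 0 ≤ R ^ 2 - ‖z‖ ^ 2 := sub_nonneg.2 (pow_le_pow_left₀ (norm_nonneg z) hz 2)
    -- outside the ball the function is negative, so that the maximum over the ball is global
    have hglob : ∀ w, (R ^ 2 - ‖w‖ ^ 2) * Real.exp (Φ w / n) ≤
        (R ^ 2 - ‖z‖ ^ 2) * Real.exp (Φ z / n) := by
      intro w
      by_cases hw : ‖w‖ ≤ R
      · exact hzmax (mem_closedBall_zero_iff.2 hw)
      · have h1 : R ^ 2 - ‖w‖ ^ 2 ≤ 0 :=
          sub_nonpos.2 (pow_le_pow_left₀ hR.le (not_le.1 hw).le 2)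
        exact (mul_nonpos_of_nonpos_of_nonneg h1 (Real.exp_pos _).le).trans
          (mul_nonneg hz2 (Real.exp_pos _).le)
    have hzρ : ‖z‖ ≤ ρ := Real.le_sqrt_of_sq_le (norm_sq_le_of_isMaxOn hn hΦ h hΛ hR hglob)
    have hΦz : Φ z ≤ Φ x₀ := hx₀ (mem_closedBall_zero_iff.2 hzρ)
    refine (hglob x).trans (mul_le_mul (by linarith [sq_nonneg ‖z‖])
      (Real.exp_le_exp.2 (by gcongr)) (Real.exp_pos _).le (sq_nonneg R))
  by_contra! hlt
  have hexp : Real.exp (Φ x₀ / n) < Real.exp (Φ x / n) := Real.exp_lt_exp.2 (by gcongr)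
  set A := Real.exp (Φ x / n)
  set B := Real.exp (Φ x₀ / n)
  have hAB : 0 < A - B := sub_pos.2 hexp
  have hA : 0 < A := Real.exp_pos _
  have hk := key (√(‖x‖ ^ 2 * A / (A - B) + 1)) (by positivity)
  rw [Real.sq_sqrt (by positivity)] at hk
  have h1 : ‖x‖ ^ 2 * A / (A - B) * (A - B) = ‖x‖ ^ 2 * A := div_mul_cancel₀ _ hAB.ne'
  nlinarith

/-! ### The strong maximum principle -/

/-- Hopf's strong maximum principle for the drift equation. A ball that touches the set of maximum
points from outside at a single point `x₁` carries the barrier `δ exp (-α ‖· - y‖²)`, which is a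
strict subsolution near `x₁` for large `α`. -/
lemma eq_of_forall_le_of_solvesDriftEquationAt {Φ : EuclideanSpace ℂ (Fin n) → ℝ} {Λ : ℝ}
    (hn : 0 < n) (hΦ : ContDiff ℝ ∞ Φ) (h : ∀ x, SolvesDriftEquationAt Φ Λ x) (hΛ : 0 < Λ)
    {x₀ : EuclideanSpace ℂ (Fin n)} (hx₀ : ∀ x, Φ x ≤ Φ x₀) (x : EuclideanSpace ℂ (Fin n)) :
    Φ x = Φ x₀ := by
  have hn' : (0 : ℝ) < n := by exact_mod_cast hn
  have hcont : Continuous Φ := hΦ.continuous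
  by_contra hne
  set M := Φ x₀ with hM
  set S : Set (EuclideanSpace ℂ (Fin n)) := {z | Φ z = M} with hS
  have hSclosed : IsClosed S := isClosed_eq hcont continuous_const
  obtain ⟨x₁, hx₁, hdist⟩ := hSclosed.exists_infDist_eq_dist ⟨x₀, rfl⟩ x
  have hfar : ∀ z ∈ S, ‖x - x₁‖ ≤ ‖x - z‖ := by
    intro z hz
    rw [← dist_eq_norm, ← dist_eq_norm, ← hdist]
    exact Metric.infDist_le_dist_of_mem hz
  set y : EuclideanSpace ℂ (Fin n) := (1 / 2 : ℝ) • (x + x₁) with hy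
  set ρ := ‖x₁ - y‖ with hρ
  have hx1y : x₁ - y = (1 / 2 : ℝ) • (x₁ - x) := by rw [hy]; module
  have hxx₁ : ‖x - x₁‖ = 2 * ρ := by
    rw [hρ, hx1y, norm_smul, norm_sub_rev]; norm_num; ring
  have hρpos : 0 < ρ := by
    have : x ≠ x₁ := fun hxe => hne (hxe ▸ hx₁)
    have := norm_pos_iff.2 (sub_ne_zero.2 this)
    linarith
  have htouch : ∀ z, ‖z - y‖ ≤ ρ → z ≠ x₁ → Φ z < M := by
    intro z hz hzne
    refine lt_of_le_of_ne (hx₀ z) fun hzM => hzne ?_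
    have h1 := hfar z hzM
    have h2 := parallelogram_law_with_norm ℝ (z - y) (x₁ - y)
    have h3 : z - y + (x₁ - y) = z - x := by rw [hy]; module
    have h4 : z - y - (x₁ - y) = z - x₁ := by abel
    rw [h3, h4, norm_sub_rev z x, ← hρ] at h2
    have h5 : ‖z - x₁‖ = 0 := by
      rw [hxx₁] at h1
      have : ‖z - x₁‖ * ‖z - x₁‖ ≤ 0 := by nlinarith [norm_nonneg (z - y)]
      exact mul_self_eq_zero.1 (le_antisymm this (mul_self_nonneg _))
    exact sub_eq_zero.1 (norm_eq_zero.1 h5)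
  -- for small `δ` the barrier, which is at most `δ`, keeps `Φ` below its maximum on the part of
  -- the sphere inside the ball; outside the ball it is smaller than at `x₁`
  obtain ⟨δ, hδ, hδS⟩ : ∃ δ > 0, ∀ z ∈ Metric.sphere x₁ (ρ / 2) ∩ Metric.closedBall y ρ,
      Φ z ≤ M - δ := by
    have hcomp : IsCompact (Metric.sphere x₁ (ρ / 2) ∩ Metric.closedBall y ρ) :=
      (isCompact_sphere x₁ (ρ / 2)).inter_right Metric.isClosed_closedBall
    rcases (Metric.sphere x₁ (ρ / 2) ∩ Metric.closedBall y ρ).eq_empty_or_nonempty with he | hne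
    · exact ⟨1, one_pos, fun z hz => by simp [he] at hz⟩
    · obtain ⟨w, hw, hwmax⟩ := hcomp.exists_isMaxOn hne hcont.continuousOn
      refine ⟨M - Φ w, sub_pos.2 (htouch w ?_ ?_), fun z hz => ?_⟩
      · simpa [dist_eq_norm] using hw.2
      · rintro rfl
        have := hw.1
        simp at this
        linarith
      · have : Φ z ≤ Φ w := hwmax hz
        linarith
  -- `α` is chosen so that the drift inequality at the maximum `z` below would give `C + 1 ≤ C`
  set C := n * Λ + Real.exp (M / n) * (2 * ρ * (‖x₁‖ + ρ)) with hC
  have hCpos : 0 < C := by positivity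
  set α := 4 * Λ * (C + 1) / ρ ^ 2 with hα
  have hαpos : 0 < α := by positivity
  obtain ⟨z, hz, hzmax⟩ := (isCompact_closedBall x₁ (ρ / 2)).exists_isMaxOn
    ⟨x₁, by simp; positivity⟩
    (by fun_prop : Continuous fun z => Φ z + δ * Real.exp (-(α * ‖z - y‖ ^ 2))).continuousOn
  have hzx₁ : Φ x₁ + δ * Real.exp (-(α * ‖x₁ - y‖ ^ 2)) ≤
      Φ z + δ * Real.exp (-(α * ‖z - y‖ ^ 2)) :=
    hzmax (Metric.mem_closedBall_self (by positivity))
  have hx₁' : Φ x₁ = M := hx₁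
  rw [hx₁'] at hzx₁
  have hzball : z ∈ Metric.ball x₁ (ρ / 2) := by
    by_contra hznot
    have hzs : z ∈ Metric.sphere x₁ (ρ / 2) :=
      le_antisymm (Metric.mem_closedBall.1 hz) (not_lt.1 hznot)
    have hpos1 : 0 < δ * Real.exp (-(α * ‖x₁ - y‖ ^ 2)) := by positivity
    by_cases hzy : ‖z - y‖ ≤ ρ
    · have h1 := hδS z ⟨hzs, by simpa [dist_eq_norm] using hzy⟩
      have h2 : Real.exp (-(α * ‖z - y‖ ^ 2)) ≤ 1 := Real.exp_le_one_iff.2 (by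
        have : 0 ≤ α * ‖z - y‖ ^ 2 := by positivity
        linarith)
      have h3 := mul_le_mul_of_nonneg_left h2 hδ.le
      linarith
    · have h2 : Real.exp (-(α * ‖z - y‖ ^ 2)) < Real.exp (-(α * ‖x₁ - y‖ ^ 2)) := by
        refine Real.exp_lt_exp.2 (neg_lt_neg (mul_lt_mul_of_pos_left ?_ hαpos))
        exact pow_lt_pow_left₀ (not_le.1 hzy) (norm_nonneg _) (by norm_num)
      have h3 := mul_lt_mul_of_pos_left h2 hδ
      have h4 := hx₀ z
      linarith
  have hloc : IsLocalMax
      (fun w => Φ w - (fun r => -(δ * Real.exp (-(α * r)))) (‖w - y‖ ^ 2)) z := by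
    filter_upwards [Metric.isOpen_ball.mem_nhds hzball] with w hw
    have h1 : Φ w + δ * Real.exp (-(α * ‖w - y‖ ^ 2)) ≤ Φ z + δ * Real.exp (-(α * ‖z - y‖ ^ 2)) :=
      hzmax (Metric.ball_subset_closedBall hw)
    simpa only [sub_neg_eq_add] using h1
  have hlin : ∀ r : ℝ,
      HasDerivAt (fun r => Real.exp (-(α * r))) (-(α * Real.exp (-(α * r)))) r := by
    intro r
    refine ((((hasDerivAt_id r).const_mul α).neg).exp).congr_deriv ?_
    simp
    ring
  obtain ⟨b, l, hpos, hexp, hineq⟩ := (h z).radial_comparison hΦ (y := y)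
    (ψ₁ := fun r => δ * α * Real.exp (-(α * r)))
    (ψ₂ := -(δ * α ^ 2 * Real.exp (-(α * ‖z - y‖ ^ 2))))
    (Filter.Eventually.of_forall fun r =>
      (((hlin r).const_mul δ).neg).congr_deriv (by ring))
    (((hlin _).const_mul (δ * α)).congr_deriv (by ring)) hloc hn
  set p := z - y with hp
  set e := Real.exp (Φ z / n) with he
  have hepos : 0 < e := Real.exp_pos _
  set κ := δ * α * Real.exp (-(α * ‖p‖ ^ 2)) with hκ
  have hκpos : 0 < κ := by positivity
  have hterm : ∀ j, (l j)⁻¹ * (-(δ * α ^ 2 * Real.exp (-(α * ‖p‖ ^ 2))) *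
      ‖inner ℂ p (b j)‖ ^ 2 + κ) ≤ κ * (Λ / e - α / (Λ * e) * ‖inner ℂ p (b j)‖ ^ 2) := by
    intro j
    have h1 : (l j)⁻¹ ≤ Λ / e := by
      rw [inv_le_comm₀ (hpos j) (by positivity), inv_div, div_le_iff₀ hΛ, mul_comm]
      exact (hexp j).1
    have h2 : 1 / (Λ * e) ≤ (l j)⁻¹ := by
      rw [one_div]
      exact inv_anti₀ (hpos j) (hexp j).2
    have h3 := mul_le_mul_of_nonneg_left h2 (by positivity : 0 ≤ α * ‖inner ℂ p (b j)‖ ^ 2)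
    have h4 : (l j)⁻¹ * (-(δ * α ^ 2 * Real.exp (-(α * ‖p‖ ^ 2))) *
      ‖inner ℂ p (b j)‖ ^ 2 + κ) =
        κ * ((l j)⁻¹ - α * ‖inner ℂ p (b j)‖ ^ 2 * (l j)⁻¹) := by rw [hκ]; ring
    rw [h4]
    refine mul_le_mul_of_nonneg_left ?_ hκpos.le
    have h5 : α / (Λ * e) * ‖inner ℂ p (b j)‖ ^ 2 =
      α * ‖inner ℂ p (b j)‖ ^ 2 * (1 / (Λ * e)) := by ring
    rw [h5]
    linarith
  have hsum : κ * inner ℝ p z ≤ κ * (n * (Λ / e) - α / (Λ * e) * ‖p‖ ^ 2) := by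
    refine hineq.trans ((Finset.sum_le_sum fun j _ => hterm j).trans (le_of_eq ?_))
    rw [← Finset.mul_sum, Finset.sum_sub_distrib, ← Finset.mul_sum, b.sum_sq_norm_inner_left]
    simp
  have hin := le_of_mul_le_mul_left hsum hκpos
  have hpz : ‖z - x₁‖ ≤ ρ / 2 := by simpa [dist_eq_norm] using hz
  have hple : ‖p‖ ≤ 2 * ρ := by
    have h1 : p = (z - x₁) + (x₁ - y) := by rw [hp]; abel
    have h2 := norm_add_le (z - x₁) (x₁ - y)
    rw [← h1] at h2
    linarith
  have hpge : ρ / 2 ≤ ‖p‖ := by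
    have h1 : x₁ - y = p - (z - x₁) := by rw [hp]; abel
    have h2 := norm_sub_le p (z - x₁)
    rw [← h1] at h2
    linarith
  have hzle : ‖z‖ ≤ ‖x₁‖ + ρ := by
    have h1 : z = x₁ + (z - x₁) := by abel
    have h2 := norm_add_le x₁ (z - x₁)
    rw [← h1] at h2
    linarith
  have hinner : -(2 * ρ * (‖x₁‖ + ρ)) ≤ inner ℝ p z := by
    have h1 := (abs_le.1 (abs_real_inner_le_norm p z)).1
    have h2 : ‖p‖ * ‖z‖ ≤ 2 * ρ * (‖x₁‖ + ρ) :=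
      mul_le_mul hple hzle (norm_nonneg _) (by positivity)
    linarith
  have heM : e ≤ Real.exp (M / n) := Real.exp_le_exp.2 (by gcongr; exact hx₀ z)
  have h1 : α * ‖p‖ ^ 2 / Λ ≤ C := by
    have h2 := mul_le_mul_of_nonneg_left (hinner.trans hin) hepos.le
    have h3 : e * (n * (Λ / e) - α / (Λ * e) * ‖p‖ ^ 2) = n * Λ - α * ‖p‖ ^ 2 / Λ := by
      field_simp
    rw [h3] at h2
    have h4 := mul_le_mul_of_nonneg_right heM (by positivity : 0 ≤ 2 * ρ * (‖x₁‖ + ρ))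
    rw [hC]
    linarith
  have h2 : C + 1 ≤ α * ‖p‖ ^ 2 / Λ := by
    have h3 : (ρ / 2) ^ 2 ≤ ‖p‖ ^ 2 := pow_le_pow_left₀ (by positivity) hpge 2
    have h4 : α * (ρ / 2) ^ 2 / Λ = C + 1 := by rw [hα]; field_simp; ring
    rw [← h4]
    gcongr
  linarith

end Frame

/-! ### Rigidity -/

theorem theorem1p3 (n : ℕ) (u : EuclideanSpace ℂ (Fin n) → ℝ)
    (hu_smooth : ContDiff ℝ ∞ u) (hu_convex : StrictConvexOn ℝ Set.univ u)
    (hu_sol : IsKahlerRicciShrinkerPotential u) (hu_comp : HasComparableEigenvalues u) :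
    IsQuadraticPolynomial u := by
  obtain ⟨Λ, hΛ, hcomp⟩ := hu_comp
  have hphase : ∃ c, ∀ x, shrinkerPhase u x = c := by
    rcases Nat.eq_zero_or_pos n with rfl | hn
    · exact ⟨shrinkerPhase u 0, fun x => by rw [Subsingleton.elim x 0]⟩
    have hdrift := solvesDriftEquationAt_shrinkerPhase hu_smooth hu_convex.convexOn hu_sol hcomp
    have hΛ0 : 0 < Λ := one_pos.trans_le hΛ
    obtain ⟨x₀, hx₀⟩ := exists_forall_le_of_solvesDriftEquationAt hn hu_smooth.shrinkerPhase
      hdrift hΛ0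
    exact ⟨shrinkerPhase u x₀, eq_of_forall_le_of_solvesDriftEquationAt hn
      hu_smooth.shrinkerPhase hdrift hΛ0 hx₀⟩
  obtain ⟨c, hc⟩ := hphase
  let B : LinearMap.BilinForm ℝ (EuclideanSpace ℂ (Fin n)) :=
    LinearMap.mk₂ ℝ (fun v w => (1 / 2) * fderiv ℝ (fderiv ℝ u) 0 v w)
      (by intros; simp; ring) (by intros; simp; ring) (by intros; simp; ring)
      (by intros; simp; ring)
  refine ⟨LinearMap.BilinMap.toQuadraticMap B, 0, -c, fun x => ?_⟩
  rw [eq_quadratic_of_shrinkerPhase_const hu_smooth hc x]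
  simp [B, sub_eq_add_neg]
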